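/- Let $t\neq 1$ be a positive integer such that $t^2+1$ is squarefree, and let $$E:\ y^2=x^3+3(t^2-3t+1)(t^2+3t+1)x^2+3(t^2+1)^4x+(t^2+1)^6,\qquad R=[0,(t^2+1)^3]\in E(\mathbb{Q}).$$ Then for every integer $m>1$ the multiple $[m]R=[x,y]$ is an affine point with $x\neq 0$, and the corresponding curve $$E'':\ Y^2=X^3+\frac{((t^2+1)^2x^{-1}+1)^2}{4}X^2+\frac{t^2((t^2+1)^2x^{-2}+x^{-1})}{2}X+\frac{t^4x^{-2}}{4}$$ is an elliptic curve with full rational $2$-torsion, i.e. every $2$-torsion point of $E''$ over $\overline{\mathbb{Q}}$ is defined over $\mathbb{Q}$. Moreover, the corresponding $a,b,c$ are rational; that is, there are $a,b,c\in\mathbb{Q}$ with $a+b+c=\sigma_1$, $ab+ac+bc=\sigma_2$, $abc=\sigma_3$, where $$\sigma_1=\frac{-t^4+4t^2-1-x^{-1}(t^2+1)^4}{(t^2-1)t},\qquad \sigma_3=\frac{t^2-1}{2t},\qquad \sigma_2=\frac{\sigma_1^2\sigma_3^2-12\sigma_3^2-6\sigma_1\sigma_3-3}{4+4\sigma_3^2}.$$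 -/

import Mathlib

open WeierstrassCurve.Affine in
/-- The elliptic curve `W` over `ℚ` has full rational `2`-torsion: every point of `W` over the
algebraic closure that is killed by `2` is a rational point. -/
def HasFullRationalTwoTorsion (W : WeierstrassCurve.Affine ℚ) : Prop := by
  classical exact
    ∀ Q : (W⁄(AlgebraicClosure ℚ)).Point, 2 • Q = 0 →
      ∃ P : (W⁄ℚ).Point, Point.baseChange (W' := W) ℚ (AlgebraicClosure ℚ) P = Q

/-- The curve `E : y² = x³ + 3(t² - 3t + 1)(t² + 3t + 1)x² + 3(t² + 1)⁴x + (t² + 1)⁶`. -/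
def curveE (t : ℚ) : WeierstrassCurve.Affine ℚ where
  a₁ := 0
  a₂ := 3 * (t ^ 2 - 3 * t + 1) * (t ^ 2 + 3 * t + 1)
  a₃ := 0
  a₄ := 3 * (t ^ 2 + 1) ^ 4
  a₆ := (t ^ 2 + 1) ^ 6

theorem curveE_nonsingular_R (t : ℚ) : (curveE t).Nonsingular 0 ((t ^ 2 + 1) ^ 3) := by
  rw [WeierstrassCurve.Affine.nonsingular_iff, WeierstrassCurve.Affine.equation_iff]
  refine ⟨by simp only [curveE]; ring, Or.inr ?_⟩
  have h : 0 < (t ^ 2 + 1) ^ 3 := by positivity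
  simp only [curveE]
  intro h'
  linarith

/-- The point `R = [0, (t² + 1)³]` on `E`. -/
def pointR (t : ℚ) : (curveE t).Point := .some 0 ((t ^ 2 + 1) ^ 3) (curveE_nonsingular_R t)

/-- The curve `E''` that corresponds to a point of `E` with first coordinate `x ≠ 0`. -/
def curveE'' (t x : ℚ) : WeierstrassCurve.Affine ℚ where
  a₁ := 0
  a₂ := ((t ^ 2 + 1) ^ 2 * x⁻¹ + 1) ^ 2 / 4
  a₃ := 0
  a₄ := t ^ 2 * ((t ^ 2 + 1) ^ 2 * x⁻¹ ^ 2 + x⁻¹) / 2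
  a₆ := t ^ 4 * x⁻¹ ^ 2 / 4

/-- The sum `a + b + c` for the triple that corresponds to a point of `E` with first
coordinate `x ≠ 0`. -/
def sigma₁ (t x : ℚ) : ℚ :=
  (-t ^ 4 + 4 * t ^ 2 - 1 - x⁻¹ * (t ^ 2 + 1) ^ 4) / ((t ^ 2 - 1) * t)

/-- The product `abc`. -/
def sigma₃ (t : ℚ) : ℚ := (t ^ 2 - 1) / (2 * t)

/-- The sum `ab + ac + bc`. -/
def sigma₂ (t x : ℚ) : ℚ :=
  (sigma₁ t x ^ 2 * sigma₃ t ^ 2 - 12 * sigma₃ t ^ 2 - 6 * sigma₁ t x * sigma₃ t - 3) /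
    (4 + 4 * sigma₃ t ^ 2)

/-! Put `S = (t² + 1)²`, `N = x + S`. The equation of `E` says that `y + 3t√-3 x` has norm `N³`. The
points at which this element is a cube in `ℚ(√-3)` are closed under addition, as in descent by a
3-isogeny, and contain `R` (`IsCubePoint.add`). So for `mR = (x, y)` there are rational `g`, `k`
with `N = g² + 3k²`, `tx = k(g² - k²)` and `y = g(g² - 9k²)`. Hence `w³ - Nw + 2tx` has the rational
roots `2k`, `-(k + g)`, `g - k`. Their squares `qᵢ` give the roots `-t²/qᵢ` of the cubic of `E''`,
and a Möbius map of the `qᵢ` gives `a, b, c`.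

The roots are distinct when `x` and `y` are nonzero, that is, when `mR ≠ ±R` and `2mR ≠ 0`. This
follows from `R` having infinite order (`addOrderOf_pointR`): for an odd prime `p ∣ t² + 1`, the
point `4R` has non-`p`-integral first coordinate, and such points are not torsion because `x / y` is
additive up to cubic error (`NearInfinity.add`). -/

/-! ### Chords, tangents and the group law near infinity -/

open WeierstrassCurve.Affine in
/-- Three collinear points on `y² = x³ + a₂x² + a₄x + a₆`, in terms of the line `y = ℓx + n`
through them. -/
theorem exists_line_add {F : Type*} [Field F] [DecidableEq F] (W : WeierstrassCurve.Affine F)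
    (ha₁ : W.a₁ = 0) (ha₃ : W.a₃ = 0) {x₁ y₁ x₂ y₂ : F} (h₁ : W.Nonsingular x₁ y₁)
    (h₂ : W.Nonsingular x₂ y₂) (hxy : ¬(x₁ = x₂ ∧ y₁ = -y₂)) :
    ∃ (ℓ n x₃ y₃ : F) (h₃ : W.Nonsingular x₃ (-y₃)),
      Point.some _ _ h₁ + Point.some _ _ h₂ = Point.some _ _ h₃ ∧
      y₁ = ℓ * x₁ + n ∧ y₂ = ℓ * x₂ + n ∧ y₃ = ℓ * x₃ + n ∧
      x₁ + x₂ + x₃ = ℓ ^ 2 - W.a₂ ∧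
      x₁ * x₂ + x₁ * x₃ + x₂ * x₃ = W.a₄ - 2 * ℓ * n ∧
      x₁ * x₂ * x₃ = n ^ 2 - W.a₆ := by
  have hneg : W.negY x₂ y₂ = -y₂ := by simp [negY, ha₁, ha₃]
  have hxy' : ¬(x₁ = x₂ ∧ y₁ = W.negY x₂ y₂) := by rwa [hneg]
  have key := addPolynomial_slope h₁.1 h₂.1 hxy'
  rw [addPolynomial_eq, neg_inj, Cubic.prod_X_sub_C_eq, Cubic.toPoly_injective] at key
  set ℓ := W.slope x₁ x₂ y₁ y₂ with hℓ
  simp only [Cubic.mk.injEq, ha₁, ha₃] at key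
  obtain ⟨-, k2, k3, k4⟩ := key
  have hy2 : y₂ = ℓ * (x₂ - x₁) + y₁ := by
    by_cases hx : x₁ = x₂
    · have e1 := (equation_iff ..).1 h₁.1
      have e2 := (equation_iff ..).1 h₂.1
      simp only [ha₁, ha₃] at e1 e2
      subst hx
      have : (y₁ - y₂) * (y₁ + y₂) = 0 := by linear_combination e1 - e2
      rcases mul_eq_zero.1 this with h | h
      · linear_combination -h
      · exact absurd ⟨rfl, eq_neg_of_add_eq_zero_left h⟩ hxy
    · rw [hℓ, slope_of_X_ne hx]
      have : x₁ - x₂ ≠ 0 := sub_ne_zero.2 hx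
      field_simp
      ring
  have hadd := Point.add_some hxy' (h₁ := h₁) (h₂ := h₂)
  have hY : W.addY x₁ x₂ y₁ ℓ = -(ℓ * W.addX x₁ x₂ ℓ + (y₁ - ℓ * x₁)) := by
    simp only [addY, negY, negAddY, ha₁, ha₃]; ring
  refine ⟨ℓ, y₁ - ℓ * x₁, W.addX x₁ x₂ ℓ, ℓ * W.addX x₁ x₂ ℓ + (y₁ - ℓ * x₁), ?_, ?_, by ring,
    by rw [hy2]; ring, rfl, ?_, ?_, ?_⟩
  · rw [← hY]; exact nonsingular_add h₁ h₂ hxy'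
  · rw [hadd]; congr 1
  · linear_combination k2
  · linear_combination -k3
  · linear_combination k4

/-- In the chart `z = x / y`, `w = 1 / y` the line is `ℓz + nw = 1`, of slope `-ℓ/n`. Subtracting
the two curve equations gives that slope as a quotient with denominator close to `1`, which also
covers the tangent case. -/
theorem line_mul_eq {F : Type*} [Field F] {a b c x₁ y₁ x₂ y₂ x₃ ℓ n z₁ w₁ z₂ w₂ : F}
    (e₁ : y₁ ^ 2 = x₁ ^ 3 + a * x₁ ^ 2 + b * x₁ + c)
    (e₂ : y₂ ^ 2 = x₂ ^ 3 + a * x₂ ^ 2 + b * x₂ + c)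
    (l₁ : y₁ = ℓ * x₁ + n) (l₂ : y₂ = ℓ * x₂ + n)
    (s₁ : x₁ + x₂ + x₃ = ℓ ^ 2 - a)
    (s₂ : x₁ * x₂ + x₁ * x₃ + x₂ * x₃ = b - 2 * ℓ * n)
    (hz₁ : x₁ = z₁ * y₁) (hw₁ : 1 = w₁ * y₁) (hz₂ : x₂ = z₂ * y₂) (hw₂ : 1 = w₂ * y₂)
    (hD : 1 - a * z₁ ^ 2 - b * z₁ * (w₁ + w₂) - c * (w₁ ^ 2 + w₁ * w₂ + w₂ ^ 2) ≠ 0) :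
    ℓ * (1 - a * z₁ ^ 2 - b * z₁ * (w₁ + w₂) - c * (w₁ ^ 2 + w₁ * w₂ + w₂ ^ 2)) =
      -n * (z₁ ^ 2 + z₁ * z₂ + z₂ ^ 2 + a * (z₁ + z₂) * w₂ + b * w₂ ^ 2) := by
  have hy₁ : y₁ ≠ 0 := by rintro rfl; simp at hw₁
  have hy₂ : y₂ ≠ 0 := by rintro rfl; simp at hw₂
  have m₁ : 1 = ℓ * z₁ + n * w₁ := by
    apply mul_right_cancel₀ hy₁; linear_combination l₁ + ℓ * hz₁ + n * hw₁
  have m₂ : 1 = ℓ * z₂ + n * w₂ := by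
    apply mul_right_cancel₀ hy₂; linear_combination l₂ + ℓ * hz₂ + n * hw₂
  have f : ∀ {x y z w : F}, y ≠ 0 → y ^ 2 = x ^ 3 + a * x ^ 2 + b * x + c → x = z * y →
      1 = w * y → w = z ^ 3 + a * z ^ 2 * w + b * z * w ^ 2 + c * w ^ 3 := by
    intro x y z w hy e hz hw
    obtain rfl : w = y⁻¹ := eq_inv_of_mul_eq_one_left hw.symm
    obtain rfl : z = x / y := by rw [hz]; field_simp
    field_simp
    linear_combination e
  have f₁ := f hy₁ e₁ hz₁ hw₁
  have f₂ := f hy₂ e₂ hz₂ hw₂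
  by_cases hz : z₁ = z₂
  · have hw : w₁ = w₂ := by
      subst hz
      have : (w₂ - w₁) *
        (1 - a * z₁ ^ 2 - b * z₁ * (w₁ + w₂) - c * (w₁ ^ 2 + w₁ * w₂ + w₂ ^ 2)) = 0 := by
        linear_combination f₂ - f₁
      exact (sub_eq_zero.1 ((mul_eq_zero.1 this).resolve_right hD)).symm
    subst hz hw
    have hy : y₁ = y₂ := by
      have hw0 : w₁ ≠ 0 := by rintro rfl; simp at hw₁
      exact mul_left_cancel₀ hw0 (hw₁.symm.trans hw₂)
    subst hy
    obtain rfl : x₁ = x₂ := by rw [hz₁, hz₂]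
    apply mul_right_cancel₀ (pow_ne_zero 2 hy₁)
    have t : 3 * x₁ ^ 2 + 2 * a * x₁ + b = 2 * ℓ * y₁ := by
      rw [l₁]; linear_combination 2 * x₁ * s₁ - s₂
    obtain rfl : w₁ = y₁⁻¹ := eq_inv_of_mul_eq_one_left hw₁.symm
    obtain rfl : z₁ = x₁ / y₁ := by rw [hz₁]; field_simp
    obtain rfl : n = y₁ - ℓ * x₁ := by rw [l₁]; ring
    field_simp
    linear_combination 3 * ℓ * e₁ + y₁ * t
  · have hz' : z₂ - z₁ ≠ 0 := sub_ne_zero.2 (Ne.symm hz)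
    apply mul_left_cancel₀ hz'
    linear_combination (1 - a * z₁ ^ 2 - b * z₁ * (w₁ + w₂) - c * (w₁ ^ 2 + w₁ * w₂ + w₂ ^ 2))
      * (m₁ - m₂) + n * (f₁ - f₂)

theorem Valuation.map_one_sub_of_lt_one {K Γ : Type*} [Field K]
    [LinearOrderedCommGroupWithZero Γ] (v : Valuation K Γ) {e : K} (he : v e < 1) :
    v (1 - e) = 1 := by
  rw [v.map_sub_eq_of_lt_left (by simpa using he), v.map_one]

theorem Valuation.div_mem_integer {K Γ : Type*} [Field K]
    [LinearOrderedCommGroupWithZero Γ] (v : Valuation K Γ) {e u : K} (he : e ∈ v.integer)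
    (hu : v u = 1) : e / u ∈ v.integer := by
  rw [Valuation.mem_integer_iff] at *
  rwa [map_div₀, hu, div_one]

/-- The parameter `z = x / y` at infinity of a point of a Weierstrass curve. -/
def zParam {F : Type*} [Field F] {W : WeierstrassCurve.Affine F} : W.Point → F
  | .zero => 0
  | .some x y _ => x / y

/-- The points `(x, y)` near infinity, with `x / y ∈ dO` and `1 / y ∈ d³O`, where `O` is the ring
of integers of the valuation `v`. -/
def NearInfinity {F Γ : Type*} [Field F] [LinearOrderedCommGroupWithZero Γ] (v : Valuation F Γ)
    (d : F) {W : WeierstrassCurve.Affine F} : W.Point → Prop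
  | .zero => True
  | .some x y _ => ∃ z ∈ v.integer, ∃ w ∈ v.integer, x = d * z * y ∧ 1 = d ^ 3 * w * y

/-- The parameter `x / y` is additive modulo `d³` on the points near infinity. -/
theorem NearInfinity.add {F Γ : Type*} [Field F] [DecidableEq F]
    [LinearOrderedCommGroupWithZero Γ]
    (v : Valuation F Γ) {d : F} (hd : v d < 1) {W : WeierstrassCurve.Affine F}
    (ha₁ : W.a₁ = 0) (ha₃ : W.a₃ = 0) (ha₂ : W.a₂ ∈ v.integer) (ha₄ : W.a₄ ∈ v.integer)
    (ha₆ : W.a₆ ∈ v.integer) {P Q : W.Point} (hP : NearInfinity v d P)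
    (hQ : NearInfinity v d Q) :
    NearInfinity v d (P + Q) ∧
      ∃ e ∈ v.integer, zParam (P + Q) = zParam P + zParam Q + d ^ 3 * e := by
  rcases P with _ | ⟨x₁, y₁, h₁⟩
  · rw [← WeierstrassCurve.Affine.Point.zero_def, zero_add]
    exact ⟨hQ, 0, zero_mem _, by simp [zParam]⟩
  rcases Q with _ | ⟨x₂, y₂, h₂⟩
  · rw [← WeierstrassCurve.Affine.Point.zero_def, add_zero]
    exact ⟨hP, 0, zero_mem _, by simp [zParam]⟩
  obtain ⟨z₁, hz₁, w₁, hw₁, hx₁, hy₁⟩ := hP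
  obtain ⟨z₂, hz₂, w₂, hw₂, hx₂, hy₂⟩ := hQ
  by_cases hxy : x₁ = x₂ ∧ y₁ = -y₂
  · rw [WeierstrassCurve.Affine.Point.add_of_Y_eq hxy.1
      (by simp [WeierstrassCurve.Affine.negY, ha₁, ha₃, hxy.2])]
    refine ⟨trivial, 0, zero_mem _, ?_⟩
    simp [zParam, hxy.1, hxy.2, div_neg]
  obtain ⟨ℓ, n, x₃, y₃, h₃, hadd, l₁, l₂, l₃, s₁, s₂, s₃⟩ :=
    exists_line_add W ha₁ ha₃ h₁ h₂ hxy
  rw [hadd]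
  have e₁ := (WeierstrassCurve.Affine.equation_iff ..).1 h₁.1
  have e₂ := (WeierstrassCurve.Affine.equation_iff ..).1 h₂.1
  simp only [ha₁, ha₃, zero_mul, add_zero] at e₁ e₂
  generalize W.a₂ = a at *
  generalize W.a₄ = b at *
  generalize W.a₆ = c at *
  have hdO : d ∈ v.integer := hd.le
  have hd2 : ∀ u ∈ v.integer, v (d ^ 2 * u) < 1 := fun u hu ↦ by
    rw [map_mul, map_pow]
    exact mul_lt_one_of_lt_of_le (pow_lt_one₀ zero_le hd two_ne_zero) hu
  set D' := a * z₁ ^ 2 + b * d ^ 2 * z₁ * (w₁ + w₂) +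
    c * d ^ 4 * (w₁ ^ 2 + w₁ * w₂ + w₂ ^ 2) with hD'
  set N := z₁ ^ 2 + z₁ * z₂ + z₂ ^ 2 + d ^ 2 * a * (z₁ + z₂) * w₂ + d ^ 4 * b * w₂ ^ 2 with hN
  have hD'O : D' ∈ v.integer := by
    apply_rules [add_mem, mul_mem, pow_mem]
  have hNO : N ∈ v.integer := by
    apply_rules [add_mem, mul_mem, pow_mem]
  have hD : v (1 - d ^ 2 * D') = 1 := v.map_one_sub_of_lt_one (hd2 _ hD'O)
  have hD0 : 1 - d ^ 2 * D' ≠ 0 := by rintro h; simp [h] at hD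
  have hslope : ℓ * (1 - d ^ 2 * D') = -n * (d ^ 2 * N) := by
    have := line_mul_eq (z₁ := d * z₁) (z₂ := d * z₂) (w₁ := d ^ 3 * w₁) (w₂ := d ^ 3 * w₂)
      e₁ e₂ l₁ l₂ s₁ s₂ hx₁ hy₁ hx₂ hy₂ (by convert hD0 using 1; rw [hD']; ring)
    rw [hD', hN]
    linear_combination this
  obtain ⟨α, hα, hℓ⟩ : ∃ α ∈ v.integer, ℓ = -n * (d ^ 2 * α) :=
    ⟨N / (1 - d ^ 2 * D'), v.div_mem_integer hNO hD, by field_simp; linear_combination hslope⟩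
  have hy₁0 : y₁ ≠ 0 := by rintro rfl; simp at hy₁
  have hy₂0 : y₂ ≠ 0 := by rintro rfl; simp at hy₂
  have hβ : 1 = n * (d ^ 3 * (w₁ - α * z₁)) := by
    apply mul_right_cancel₀ hy₁0
    linear_combination l₁ + n * hy₁ + ℓ * hx₁ + (d * z₁ * y₁) * hℓ
  -- In the `(z, w)` chart the line is now `w = d²α z + d³β`.
  set β := w₁ - α * z₁ with hβdef
  have hβO : β ∈ v.integer := sub_mem hw₁ (mul_mem hα hz₁)
  have hn : n ≠ 0 := by rintro rfl; simp at hβ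
  set G := -(a * α + b * d ^ 2 * α ^ 2 + c * d ^ 4 * α ^ 3) with hG
  have hGO : G ∈ v.integer := by
    apply_rules [neg_mem, add_mem, mul_mem, pow_mem]
  have hF : v (1 - d ^ 2 * G) = 1 := v.map_one_sub_of_lt_one (hd2 _ hGO)
  have hF0 : 1 - d ^ 2 * G ≠ 0 := by rintro h; simp [h] at hF
  have hprod : y₁ * y₂ * y₃ = n ^ 3 * (1 - d ^ 2 * G) := by
    rw [hG]
    have : y₁ * y₂ * y₃ = n ^ 3 - a * ℓ * n ^ 2 + b * ℓ ^ 2 * n - c * ℓ ^ 3 := by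
      rw [l₁, l₂, l₃]
      linear_combination ℓ ^ 3 * s₃ + ℓ ^ 2 * n * s₂ + ℓ * n ^ 2 * s₁
    rw [this, hℓ]
    ring
  have hy₃0 : y₃ ≠ 0 := by
    rintro rfl
    rw [mul_zero] at hprod
    exact mul_ne_zero (pow_ne_zero 3 hn) hF0 hprod.symm
  -- Vieta: substituting the line into the curve gives a cubic in `z` with leading coefficient `1 -
  -- d²G`, whose roots sum to `-d³e`. Negating the third point changes the sign of its `z`.
  set e := β * ((a + 2 * b * (d ^ 2 * α) + 3 * c * (d ^ 2 * α) ^ 2) / (1 - d ^ 2 * G)) with he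
  have h2 : (2 : F) ∈ v.integer := by exact_mod_cast natCast_mem v.integer 2
  have h3 : (3 : F) ∈ v.integer := by exact_mod_cast natCast_mem v.integer 3
  have heO : e ∈ v.integer := by
    refine mul_mem hβO (v.div_mem_integer ?_ hF)
    apply_rules [add_mem, mul_mem, pow_mem]
  have hE : d ^ 3 * e * (y₁ * y₂ * y₃) = a * n ^ 2 - 2 * b * ℓ * n + 3 * c * ℓ ^ 2 := by
    rw [hprod, he, hℓ]
    clear_value β G
    field_simp
    linear_combination -(a + d ^ 2 * α * (2 * b + d ^ 2 * α * 3 * c)) * hβ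
  clear_value e
  have hsum : x₃ = d * (z₁ + z₂ + d ^ 2 * e) * -y₃ := by
    apply mul_right_cancel₀ (mul_ne_zero hy₁0 hy₂0)
    have : x₁ * y₂ * y₃ + x₂ * y₁ * y₃ + x₃ * y₁ * y₂ =
        -(a * n ^ 2 - 2 * b * ℓ * n + 3 * c * ℓ ^ 2) := by
      rw [l₁, l₂, l₃]
      linear_combination 3 * ℓ ^ 2 * s₃ + 2 * ℓ * n * s₂ + n ^ 2 * s₁
    linear_combination this + hE - y₂ * y₃ * hx₁ - y₁ * y₃ * hx₂
  refine ⟨⟨z₁ + z₂ + d ^ 2 * e, ?_, -β + α * (z₁ + z₂ + d ^ 2 * e), ?_, hsum, ?_⟩, e, heO, ?_⟩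
  · apply_rules [add_mem, mul_mem, pow_mem]
  · apply_rules [add_mem, mul_mem, pow_mem, neg_mem]
  · clear_value β
    linear_combination hβ - d ^ 3 * β * (l₃ + x₃ * hℓ) + d ^ 2 * α * hsum - x₃ * d ^ 2 * α * hβ
  · simp only [zParam]
    rw [hsum, hx₁, hx₂]
    field_simp

theorem NearInfinity.nsmul {F Γ : Type*} [Field F] [DecidableEq F]
    [LinearOrderedCommGroupWithZero Γ]
    (v : Valuation F Γ) {d : F} (hd : v d < 1) {W : WeierstrassCurve.Affine F}
    (ha₁ : W.a₁ = 0) (ha₃ : W.a₃ = 0) (ha₂ : W.a₂ ∈ v.integer) (ha₄ : W.a₄ ∈ v.integer)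
    (ha₆ : W.a₆ ∈ v.integer) {P : W.Point} (hP : NearInfinity v d P) (k : ℕ) :
    NearInfinity v d (k • P) ∧ ∃ e ∈ v.integer, zParam (k • P) = k * zParam P + d ^ 3 * e := by
  induction k with
  | zero => exact ⟨by simp [NearInfinity, WeierstrassCurve.Affine.Point.zero_def], 0,
      zero_mem _, by simp [zParam, WeierstrassCurve.Affine.Point.zero_def]⟩
  | succ k ih =>
    obtain ⟨hk, e, he, hz⟩ := ih
    obtain ⟨h, e', he', hz'⟩ := hk.add v hd ha₁ ha₃ ha₂ ha₄ ha₆ hP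
    rw [succ_nsmul]
    exact ⟨h, e + e', add_mem he he', by rw [hz', hz]; push_cast; ring⟩

/-- The quotient `y² / x³ = 1 + a₂/x + a₄/x² + a₆/x³` is a unit, so `(x / y)²` has the valuation of
`1 / x`. -/
theorem nearInfinity_of_one_lt {F Γ : Type*} [Field F] [LinearOrderedCommGroupWithZero Γ]
    (v : Valuation F Γ) {W : WeierstrassCurve.Affine F}
    (ha₁ : W.a₁ = 0) (ha₃ : W.a₃ = 0) (ha₂ : W.a₂ ∈ v.integer) (ha₄ : W.a₄ ∈ v.integer)
    (ha₆ : W.a₆ ∈ v.integer) {x y : F} (h : W.Nonsingular x y) (hx : 1 < v x) :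
    y ≠ 0 ∧ v (x / y) < 1 ∧ NearInfinity v (x / y) (.some x y h) := by
  have e := (WeierstrassCurve.Affine.equation_iff ..).1 h.1
  simp only [ha₁, ha₃, zero_mul, add_zero] at e
  have hx0 : x ≠ 0 := by rintro rfl; simp at hx
  have hu : v x⁻¹ < 1 := by rw [map_inv₀]; exact inv_lt_one_of_one_lt₀ hx
  have huO : x⁻¹ ∈ v.integer := hu.le
  have hG : W.a₂ + W.a₄ * x⁻¹ + W.a₆ * x⁻¹ ^ 2 ∈ v.integer := by
    apply_rules [add_mem, mul_mem, pow_mem]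
  have hv : v (1 - -(x⁻¹ * (W.a₂ + W.a₄ * x⁻¹ + W.a₆ * x⁻¹ ^ 2))) = 1 := by
    apply v.map_one_sub_of_lt_one
    rw [Valuation.map_neg, map_mul]
    exact mul_lt_one_of_lt_of_le hu hG
  have hq : 1 - -(x⁻¹ * (W.a₂ + W.a₄ * x⁻¹ + W.a₆ * x⁻¹ ^ 2)) = y ^ 2 / x ^ 3 := by
    rw [e]; field_simp; ring
  rw [hq] at hv
  have hy0 : y ≠ 0 := by rintro rfl; simp at hv
  refine ⟨hy0, ?_, 1, one_mem _, y ^ 2 / x ^ 3, hv.le, by field_simp, by field_simp⟩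
  have : v (x / y) ^ 2 < 1 := by
    have h2 : (x / y) ^ 2 * (y ^ 2 / x ^ 3) = x⁻¹ := by field_simp
    rwa [← h2, map_mul, hv, mul_one, map_pow] at hu
  exact (pow_lt_one_iff_of_nonneg zero_le two_ne_zero).1 this

theorem NearInfinity.one_lt {F Γ : Type*} [Field F] [LinearOrderedCommGroupWithZero Γ]
    (v : Valuation F Γ) {d : F} (hd : v d < 1) {W : WeierstrassCurve.Affine F}
    (ha₁ : W.a₁ = 0) (ha₃ : W.a₃ = 0) (ha₂ : W.a₂ ∈ v.integer) (ha₄ : W.a₄ ∈ v.integer)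
    (ha₆ : W.a₆ ∈ v.integer) {x y : F} (h : W.Nonsingular x y)
    (hP : NearInfinity v d (.some x y h)) : 1 < v x := by
  have e := (WeierstrassCurve.Affine.equation_iff ..).1 h.1
  simp only [ha₁, ha₃, zero_mul, add_zero] at e
  obtain ⟨z, hz, w, hw, hx, hy⟩ := hP
  by_contra hlt
  have hxO : x ∈ v.integer := not_lt.1 hlt
  have hy2 : y ^ 2 ∈ v.integer := by
    rw [e]
    apply_rules [add_mem, mul_mem, pow_mem]
  have hyO : y ∈ v.integer := by
    rw [Valuation.mem_integer_iff, map_pow] at hy2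
    exact (pow_le_one_iff_of_nonneg zero_le two_ne_zero).1 hy2
  have : v (d ^ 3 * w * y) < 1 := by
    rw [map_mul, map_mul, map_pow]
    exact mul_lt_one_of_lt_of_le
      (mul_lt_one_of_lt_of_le (pow_lt_one₀ zero_le hd three_ne_zero) hw) hyO
  rw [← hy, map_one] at this
  exact this.false

/-! ### Points with non-integral first coordinate are not torsion -/

theorem padicValuation_le_of_lt_one {p : ℕ} [Fact p.Prime] {q : ℚ}
    (h : Rat.padicValuation p q < 1) : Rat.padicValuation p q ≤ Rat.padicValuation p p := by
  rw [Rat.padicValuation_self]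
  by_cases hq : q = 0
  · simp [hq]
  · simp only [Rat.padicValuation, Valuation.coe_mk, MonoidWithZeroHom.coe_mk, ZeroHom.coe_mk,
      if_neg hq] at h ⊢
    rw [← WithZero.exp_zero, WithZero.exp_lt_exp] at h
    rw [WithZero.exp_le_exp]
    omega

theorem padicValuation_natCast_eq_one {p n : ℕ} [Fact p.Prime] (h : ¬p ∣ n) :
    Rat.padicValuation p n = 1 := by
  have := Int.padicValuation_eq_one_iff (p := p) (x := n)
  rw [← Rat.padicValuation_cast] at this
  exact_mod_cast this.2 (by exact_mod_cast h)

theorem padicValuation_le_prime {p ℓ : ℕ} [hp : Fact p.Prime] (hℓ : ℓ.Prime) :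
    Rat.padicValuation p p ≤ Rat.padicValuation p ℓ := by
  by_cases h : p = ℓ
  · subst h; exact le_rfl
  · rw [padicValuation_natCast_eq_one (mt (Nat.prime_dvd_prime_iff_eq hp.out hℓ).1 h)]
    exact_mod_cast (Rat.padicValuation_cast p p).trans_le (Int.padicValuation_le_one p p)

/-- A point of `y² = x³ + a₂x² + a₄x + a₆` whose first coordinate is not `p`-integral has infinite
order, if the coefficients are `p`-integral. -/
theorem addOrderOf_eq_zero_of_one_lt (p : ℕ) [Fact p.Prime] {W : WeierstrassCurve.Affine ℚ}
    (ha₁ : W.a₁ = 0) (ha₃ : W.a₃ = 0) (ha₂ : W.a₂ ∈ (Rat.padicValuation p).integer)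
    (ha₄ : W.a₄ ∈ (Rat.padicValuation p).integer) (ha₆ : W.a₆ ∈ (Rat.padicValuation p).integer)
    {x y : ℚ} (h : W.Nonsingular x y) (hx : 1 < Rat.padicValuation p x) :
    addOrderOf (WeierstrassCurve.Affine.Point.some x y h) = 0 := by
  set v := Rat.padicValuation p
  have main : ∀ {x y : ℚ} (h : W.Nonsingular x y) (_ : 1 < v x) (ℓ : ℕ) (_ : ℓ.Prime),
      ℓ • WeierstrassCurve.Affine.Point.some x y h ≠ 0 := by
    intro x y h hx ℓ hℓ h0
    obtain ⟨hy, hd, hP⟩ := nearInfinity_of_one_lt v ha₁ ha₃ ha₂ ha₄ ha₆ h hx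
    obtain ⟨-, e, he, hz⟩ := hP.nsmul v hd ha₁ ha₃ ha₂ ha₄ ha₆ ℓ
    rw [h0] at hz
    have hx0 : x ≠ 0 := by rintro rfl; simp at hx
    change 0 = ℓ * (x / y) + (x / y) ^ 3 * e at hz
    have hd0 : x / y ≠ 0 := div_ne_zero hx0 hy
    generalize x / y = d at *
    -- This forces `v ℓ < v d ≤ v p ≤ v ℓ`, also when `ℓ = p`.
    have hl : (ℓ : ℚ) = d * (d * -e) := by
      apply mul_right_cancel₀ hd0
      linear_combination -hz
    have h1 := padicValuation_le_prime (p := p) hℓ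
    have h2 := padicValuation_le_of_lt_one hd
    have h3 : v (d * (d * -e)) < v d := by
      rw [map_mul]
      refine mul_lt_of_lt_one_right (zero_lt_iff.2 ((map_ne_zero v).2 hd0)) ?_
      rw [map_mul]
      exact mul_lt_one_of_lt_of_le hd (neg_mem he)
    rw [← hl] at h3
    exact (h1.trans_lt h3).not_ge h2
  by_contra hN
  set P := WeierstrassCurve.Affine.Point.some x y h with hPdef
  have hN1 : addOrderOf P ≠ 1 := by
    rw [Ne, AddMonoid.addOrderOf_eq_one_iff]
    exact WeierstrassCurve.Affine.Point.some_ne_zero h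
  -- Pass to the multiple `k • P` of prime order `ℓ`; it is still near infinity.
  obtain ⟨ℓ, hℓ, k, hk⟩ := Nat.exists_prime_and_dvd hN1
  obtain ⟨-, hd, hP⟩ := nearInfinity_of_one_lt v ha₁ ha₃ ha₂ ha₄ ha₆ h hx
  obtain ⟨hQ, -⟩ := hP.nsmul v hd ha₁ ha₃ ha₂ ha₄ ha₆ k
  have hℓk : ℓ • (k • P) = 0 := by
    rw [← mul_nsmul', ← hk, addOrderOf_nsmul_eq_zero]
  rcases hkP : k • P with _ | ⟨x', y', h'⟩
  · have hdvd := addOrderOf_dvd_of_nsmul_eq_zero hkP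
    have hk0 : 0 < k := Nat.pos_of_ne_zero (by rintro rfl; simp [hN] at hk)
    have := Nat.le_of_dvd hk0 hdvd
    rw [hk] at this
    nlinarith [hℓ.two_le]
  · rw [← hPdef, hkP] at hQ
    rw [hkP] at hℓk
    exact main h' (hQ.one_lt v hd ha₁ ha₃ ha₂ ha₄ ha₆ h') ℓ hℓ hℓk

/-! ### The point `R` has infinite order -/

open WeierstrassCurve.Affine in
theorem exists_double {F : Type*} [Field F] [DecidableEq F] [NeZero (2 : F)]
    (W : WeierstrassCurve.Affine F)
    (ha₁ : W.a₁ = 0) (ha₃ : W.a₃ = 0) {x y : F} (h : W.Nonsingular x y) (hy : y ≠ 0) :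
    ∃ (ℓ x' y' : F) (h' : W.Nonsingular x' y'), 2 • Point.some _ _ h = Point.some _ _ h' ∧
      2 * y * ℓ = 3 * x ^ 2 + 2 * W.a₂ * x + W.a₄ ∧ x' = ℓ ^ 2 - W.a₂ - 2 * x ∧
      y' = -(ℓ * (x' - x) + y) := by
  have hxy : ¬(x = x ∧ y = -y) := fun h ↦ hy (by
    have : 2 * y = 0 := by linear_combination h.2
    simpa [two_ne_zero] using this)
  obtain ⟨ℓ, n, x₃, y₃, h₃, hadd, l₁, l₂, l₃, s₁, s₂, s₃⟩ := exists_line_add W ha₁ ha₃ h h hxy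
  refine ⟨ℓ, x₃, -y₃, h₃, by rw [two_nsmul, hadd], ?_, ?_, ?_⟩
  · linear_combination 2 * ℓ * l₁ - 2 * x * s₁ + s₂
  · linear_combination s₁
  · linear_combination l₁ - l₃

/-- Otherwise `t² + 1 > 4` is a power of `2`, hence divisible by `4`, but `-1` is not a square
modulo `4`. -/
theorem exists_odd_prime_dvd_sq_add_one {t : ℕ} (ht : 1 < t) :
    ∃ p, p.Prime ∧ p ∣ t ^ 2 + 1 ∧ Odd p := by
  rcases Nat.eq_two_pow_or_exists_odd_prime_and_dvd (t ^ 2 + 1) with ⟨k, hk⟩ | h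
  · exfalso
    have h4 : 4 < t ^ 2 + 1 := by nlinarith
    have hk2 : 2 ≤ k := by
      by_contra hlt
      have : k = 0 ∨ k = 1 := by omega
      rcases this with rfl | rfl <;> omega
    obtain ⟨j, rfl⟩ := Nat.exists_eq_add_of_le hk2
    have h1 : (t ^ 2 + 1) % 4 = 0 := by rw [hk, pow_add]; omega
    have h2 : t % 4 = 0 ∨ t % 4 = 1 ∨ t % 4 = 2 ∨ t % 4 = 3 := by omega
    rcases h2 with h | h | h | h <;> simp [Nat.add_mod, Nat.pow_mod, h] at h1
  · exact h

theorem addOrderOf_pointR {t : ℕ} (ht : 1 < t) : addOrderOf (pointR (t : ℚ)) = 0 := by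
  obtain ⟨p, hp, hpt, hpo⟩ := exists_odd_prime_dvd_sq_add_one ht
  have : Fact p.Prime := ⟨hp⟩
  set v := Rat.padicValuation p with hv
  have hp2 : ¬p ∣ 2 := fun h ↦ by
    rw [(Nat.prime_dvd_prime_iff_eq hp Nat.prime_two).1 h] at hpo
    exact absurd hpo (by decide)
  have hp3 : ¬p ∣ 3 := fun h ↦ by
    obtain rfl := (Nat.prime_dvd_prime_iff_eq hp Nat.prime_three).1 h
    have h1 := Nat.mod_eq_zero_of_dvd hpt
    have h2 : t % 3 = 0 ∨ t % 3 = 1 ∨ t % 3 = 2 := by omega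
    rcases h2 with h | h | h <;> simp [Nat.add_mod, Nat.pow_mod, h] at h1
  have hpt' : ¬p ∣ t := fun h ↦ hp.one_lt.ne' (Nat.dvd_one.1
    ((Nat.dvd_add_right (dvd_pow h two_ne_zero)).1 hpt))
  have v2 : v 2 = 1 := by exact_mod_cast padicValuation_natCast_eq_one hp2
  have v3 : v 3 = 1 := by exact_mod_cast padicValuation_natCast_eq_one hp3
  have vt : v t = 1 := padicValuation_natCast_eq_one hpt'
  obtain ⟨u, hu⟩ : ∃ u : ℚ, (t : ℚ) ^ 2 + 1 = 2 * u := ⟨((t : ℚ) ^ 2 + 1) / 2, by ring⟩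
  have vu : v u < 1 := by
    have h1 : v ((t : ℚ) ^ 2 + 1) < 1 := by
      have := (Int.padicValuation_lt_one_iff (p := p) (x := t ^ 2 + 1)).2 (by exact_mod_cast hpt)
      rw [← Rat.padicValuation_cast] at this
      exact_mod_cast this
    rwa [hu, map_mul, v2, one_mul] at h1
  have ht0 : (1 : ℚ) < t := by exact_mod_cast ht
  have hu0 : 0 < u := by nlinarith
  have hW₁ : (curveE (t : ℚ)).a₁ = 0 := rfl
  have hW₃ : (curveE (t : ℚ)).a₃ = 0 := rfl
  have hW₂ : (curveE (t : ℚ)).a₂ = 3 * (4 * u ^ 2 - 9 * t ^ 2) := by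
    change 3 * ((t : ℚ) ^ 2 - 3 * t + 1) * ((t : ℚ) ^ 2 + 3 * t + 1) = _
    linear_combination 3 * (t ^ 2 + 1 + 2 * u) * hu
  have hW₄ : (curveE (t : ℚ)).a₄ = 3 * (2 * u) ^ 4 := by rw [← hu]; rfl
  have hW₆ : (curveE (t : ℚ)).a₆ = (2 * u) ^ 6 := by rw [← hu]; rfl
  have nat_mem (n : ℕ) : (n : ℚ) ∈ v.integer := natCast_mem v.integer n
  have huO : u ∈ v.integer := vu.le
  have h2O : (2 : ℚ) ∈ v.integer := nat_mem 2
  have h3O : (3 : ℚ) ∈ v.integer := nat_mem 3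
  have htO : (t : ℚ) ∈ v.integer := nat_mem t
  have hO : ∀ m n : ℕ, (m * u ^ 2 - n * t ^ 2 : ℚ) ∈ v.integer := fun m n ↦
    sub_mem (mul_mem (nat_mem m) (pow_mem huO 2)) (mul_mem (nat_mem n) (pow_mem htO 2))
  have hO₂ : (curveE (t : ℚ)).a₂ ∈ v.integer := by
    rw [hW₂]
    exact mul_mem h3O (by exact_mod_cast hO 4 9)
  have hO₄ : (curveE (t : ℚ)).a₄ ∈ v.integer := by
    rw [hW₄]; apply_rules [mul_mem, pow_mem]
  have hO₆ : (curveE (t : ℚ)).a₆ ∈ v.integer := by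
    rw [hW₆]; apply_rules [mul_mem, pow_mem]
  obtain ⟨ℓ, x, y, h, hR, hℓ, hx, hy⟩ := exists_double (curveE (t : ℚ)) hW₁ hW₃
    (curveE_nonsingular_R t) (by positivity)
  rw [hu, hW₄] at hℓ
  rw [hW₂] at hx
  rw [hu] at hy
  obtain rfl : ℓ = 3 * u := by
    apply mul_left_cancel₀ (show 2 * (2 * u) ^ 3 ≠ 0 by positivity)
    linear_combination hℓ
  have hx' : x = 27 * t ^ 2 - 3 * u ^ 2 := by linear_combination hx
  have hy' : y = u * (u ^ 2 - 81 * t ^ 2) := by rw [hy, hx']; ring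
  have hy0 : y ≠ 0 := by
    rw [hy']
    refine mul_ne_zero hu0.ne' fun h0 ↦ ?_
    have h1 : (u - 9 * t) * (u + 9 * t) = 0 := by linear_combination h0
    have h2 : u = 9 * t := by
      rcases mul_eq_zero.1 h1 with h | h
      · linarith
      · nlinarith
    rw [h2] at hu
    have h3 : t ^ 2 + 1 = t * 18 := by
      have : (t : ℚ) ^ 2 + 1 = t * 18 := by linear_combination hu
      exact_mod_cast this
    have h4 : t ∣ 1 := (Nat.dvd_add_right (dvd_pow_self t two_ne_zero)).1 ⟨18, h3⟩
    exact ht.ne' (Nat.dvd_one.1 h4)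
  obtain ⟨ℓ', x', y', h', hR', hℓ', hx4, -⟩ := exists_double (curveE (t : ℚ)) hW₁ hW₃ h hy0
  have vnum : v (2 * y * ℓ') = 1 := by
    -- Modulo `p` the numerator of the tangent slope at `2R` is the unit `3⁶t⁴`, while its
    -- denominator `2y` vanishes; so `4R` reduces to infinity.
    have key : 2 * y * ℓ' = 3 ^ 6 * t ^ 4 - -(u * (3 * u * (108 * t ^ 2 + u ^ 2))) := by
      rw [hℓ', hW₂, hW₄, hx']; ring
    have h1 : v (3 ^ 6 * (t : ℚ) ^ 4) = 1 := by simp [v3, vt]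
    rw [key, v.map_sub_eq_of_lt_left, h1]
    rw [h1, Valuation.map_neg, map_mul]
    refine mul_lt_one_of_lt_of_le vu ?_
    have h108 : (108 : ℚ) ∈ v.integer := nat_mem 108
    change 3 * u * (108 * t ^ 2 + u ^ 2) ∈ v.integer
    apply_rules [mul_mem, add_mem, pow_mem]
  have vy : v (2 * y) < 1 := by
    rw [hy', mul_left_comm, map_mul]
    refine mul_lt_one_of_lt_of_le vu (mul_mem h2O ?_)
    convert hO 1 81 using 1
    push_cast
    ring
  have vℓ : 1 < v ℓ' := by
    by_contra hle
    have : v (2 * y * ℓ') < 1 := by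
      rw [map_mul]; exact mul_lt_one_of_lt_of_le vy (not_lt.1 hle)
    exact this.ne vnum
  have vx' : 1 < v x' := by
    have hxO : (curveE (t : ℚ)).a₂ + 2 * x ∈ v.integer := by
      refine add_mem hO₂ (mul_mem h2O ?_)
      rw [hx']
      have := neg_mem (hO 3 27)
      push_cast at this
      convert this using 1
      ring
    by_contra hle
    have h1 : ℓ' ^ 2 ∈ v.integer := by
      have : ℓ' ^ 2 = x' + ((curveE (t : ℚ)).a₂ + 2 * x) := by rw [hx4]; ring
      rw [this]
      exact add_mem (not_lt.1 hle) hxO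
    rw [Valuation.mem_integer_iff, map_pow] at h1
    exact vℓ.not_ge ((pow_le_one_iff_of_nonneg zero_le two_ne_zero).1 h1)
  have h0 := addOrderOf_eq_zero_of_one_lt p hW₁ hW₃ hO₂ hO₄ hO₆ h' vx'
  have h4 : 4 • pointR (t : ℚ) = WeierstrassCurve.Affine.Point.some x' y' h' := by
    rw [← hR', ← hR, ← mul_nsmul]; rfl
  rw [← h4] at h0
  by_contra hne
  rw [addOrderOf_eq_zero_iff] at h0
  exact h0 ((isOfFinAddOrder_iff_nsmul_eq_zero.2 ⟨addOrderOf (pointR (t : ℚ)),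
    Nat.pos_of_ne_zero hne, addOrderOf_nsmul_eq_zero _⟩).nsmul)

/-! ### Cubes in `ℚ(√-3)` -/

/-- The points `(x, y)` of `curveE t` for which `y + 3t√-3x` is a cube `(g + h√-3)³`. -/
def IsCubePoint {t : ℚ} : (curveE t).Point → Prop
  | .zero => True
  | .some x y _ => ∃ g h : ℚ, y = g ^ 3 - 9 * g * h ^ 2 ∧ t * x = h * (g ^ 2 - h ^ 2)

theorem curveE_equation {t x y : ℚ} (h : (curveE t).Nonsingular x y) :
    y ^ 2 + 27 * t ^ 2 * x ^ 2 = (x + (t ^ 2 + 1) ^ 2) ^ 3 := by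
  have e := (WeierstrassCurve.Affine.equation_iff ..).1 h.1
  simp only [curveE] at e
  linear_combination e

theorem add_eq_norm_of_isCubePoint {t x y g k : ℚ} (h : (curveE t).Nonsingular x y)
    (hy : y = g ^ 3 - 9 * g * k ^ 2) (hx : t * x = k * (g ^ 2 - k ^ 2)) :
    x + (t ^ 2 + 1) ^ 2 = g ^ 2 + 3 * k ^ 2 := by
  have h3 : Odd 3 := by decide
  apply h3.strictMono_pow.injective
  change (x + (t ^ 2 + 1) ^ 2) ^ 3 = (g ^ 2 + 3 * k ^ 2) ^ 3
  rw [← curveE_equation h, hy]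
  linear_combination 27 * (t * x + k * (g ^ 2 - k ^ 2)) * hx

theorem norm_ne_zero_of_isCubePoint {t x y g k : ℚ} (ht : t ≠ 0) (h : (curveE t).Nonsingular x y)
    (hy : y = g ^ 3 - 9 * g * k ^ 2) (hx : t * x = k * (g ^ 2 - k ^ 2)) :
    g ^ 2 + 3 * k ^ 2 ≠ 0 := by
  intro h0
  have hg : g = 0 := by
    have : g ^ 2 = 0 := by nlinarith [sq_nonneg g, sq_nonneg k]
    simpa using this
  have hk : k = 0 := by
    have : k ^ 2 = 0 := by nlinarith [sq_nonneg g, sq_nonneg k]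
    simpa using this
  have hn := add_eq_norm_of_isCubePoint h hy hx
  subst hg hk
  have hx0 : x = 0 := by simpa [ht] using hx
  subst hx0
  have : 0 < (t ^ 2 + 1) ^ 2 := by positivity
  linarith

theorem IsCubePoint.add {t : ℚ} (ht : t ≠ 0) {P Q : (curveE t).Point} (hP : IsCubePoint P)
    (hQ : IsCubePoint Q) : IsCubePoint (P + Q) := by
  rcases P with _ | ⟨x₁, y₁, h₁⟩
  · rwa [← WeierstrassCurve.Affine.Point.zero_def, zero_add]
  rcases Q with _ | ⟨x₂, y₂, h₂⟩
  · rwa [← WeierstrassCurve.Affine.Point.zero_def, add_zero]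
  obtain ⟨g₁, k₁, hy₁, hx₁⟩ := hP
  obtain ⟨g₂, k₂, hy₂, hx₂⟩ := hQ
  by_cases hxy : x₁ = x₂ ∧ y₁ = -y₂
  · rw [WeierstrassCurve.Affine.Point.add_of_Y_eq hxy.1
      (by simp [WeierstrassCurve.Affine.negY, curveE, hxy.2])]
    trivial
  obtain ⟨ℓ, n, x₃, y₃, h₃, hadd, l₁, l₂, l₃, s₁, s₂, s₃⟩ :=
    exists_line_add (curveE t) rfl rfl h₁ h₂ hxy
  rw [hadd]
  simp only [curveE] at s₁ s₂ s₃
  have hn₁ := norm_ne_zero_of_isCubePoint ht h₁ hy₁ hx₁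
  have hn₂ := norm_ne_zero_of_isCubePoint ht h₂ hy₂ hx₂
  -- `A + B√-3` is the product of the two given cube roots, and `M` is its norm.
  obtain ⟨A, hA⟩ : ∃ A, A = g₁ * g₂ - 3 * k₁ * k₂ := ⟨_, rfl⟩
  obtain ⟨B, hB⟩ : ∃ B, B = g₁ * k₂ + g₂ * k₁ := ⟨_, rfl⟩
  obtain ⟨M, hM⟩ : ∃ M, M = (g₁ ^ 2 + 3 * k₁ ^ 2) * (g₂ ^ 2 + 3 * k₂ ^ 2) := ⟨_, rfl⟩
  have hM0 : M ≠ 0 := hM ▸ mul_ne_zero hn₁ hn₂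
  have hMAB : M = A ^ 2 + 3 * B ^ 2 := by rw [hM, hA, hB]; ring
  have hF : y₁ * y₂ - 27 * (t * x₁) * (t * x₂) = A ^ 3 - 9 * A * B ^ 2 := by
    rw [hy₁, hy₂, hx₁, hx₂, hA, hB]; ring
  have hK : y₁ * (t * x₂) + (t * x₁) * y₂ = A ^ 2 * B - B ^ 3 := by
    rw [hy₁, hy₂, hx₁, hx₂, hA, hB]; ring
  -- Over the three points of the line, the product of `y + 3t√-3 x` is `(U - V√-3)³`: evaluate the
  -- intersection cubic where `ℓx + n = -3t√-3 x`, so that only `(x + S)³` survives.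
  obtain ⟨U, hU⟩ : ∃ U, U = n - (t ^ 2 + 1) ^ 2 * ℓ := ⟨_, rfl⟩
  obtain ⟨V, hV⟩ : ∃ V, V = 3 * t * (t ^ 2 + 1) ^ 2 := ⟨_, rfl⟩
  have re : (A ^ 3 - 9 * A * B ^ 2) * y₃ - 27 * (A ^ 2 * B - B ^ 3) * (t * x₃) =
      U ^ 3 - 9 * U * V ^ 2 := by
    rw [← hF, ← hK, l₁, l₂, l₃, hU, hV]
    linear_combination (ℓ ^ 3 - 81 * t ^ 2 * ℓ) * s₃ + (ℓ ^ 2 * n - 27 * t ^ 2 * n) * s₂ +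
      ℓ * n ^ 2 * s₁
  have im : (A ^ 3 - 9 * A * B ^ 2) * (t * x₃) + (A ^ 2 * B - B ^ 3) * y₃ =
      -(U ^ 2 * V - V ^ 3) := by
    rw [← hF, ← hK, l₁, l₂, l₃, hU, hV]
    linear_combination (3 * t * ℓ ^ 2 - 27 * t ^ 3) * s₃ + 2 * t * ℓ * n * s₂ + t * n ^ 2 * s₁
  -- Changing `y₃` to `-y₃` is conjugation with a sign, so the cube root is `-(U + V√-3) / (A -
  -- B√-3)`.
  refine ⟨-(U * A - 3 * V * B) / M, -(U * B + V * A) / M, ?_, ?_⟩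
  · field_simp
    rw [hMAB]
    linear_combination -(A ^ 3 - 9 * A * B ^ 2) * re - 27 * (A ^ 2 * B - B ^ 3) * im
  · field_simp
    rw [hMAB]
    linear_combination -(A ^ 2 * B - B ^ 3) * re + (A ^ 3 - 9 * A * B ^ 2) * im

theorem isCubePoint_nsmul_pointR {t : ℚ} (ht : t ≠ 0) (m : ℕ) : IsCubePoint (m • pointR t) := by
  induction m with
  | zero => simp [IsCubePoint, WeierstrassCurve.Affine.Point.zero_def]
  | succ m ih =>
    rw [succ_nsmul]
    exact ih.add ht ⟨t ^ 2 + 1, 0, by ring, by ring⟩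

/-! ### The 2-torsion of `E''` and the rational triple -/

/-- `W` is the curve `y² = (x + r₁)(x + r₂)(x + r₃)`. -/
structure HasRoots {R : Type*} [CommRing R] (W : WeierstrassCurve R) (r₁ r₂ r₃ : R) : Prop where
  a₁ : W.a₁ = 0
  a₂ : W.a₂ = r₁ + r₂ + r₃
  a₃ : W.a₃ = 0
  a₄ : W.a₄ = r₁ * r₂ + r₁ * r₃ + r₂ * r₃
  a₆ : W.a₆ = r₁ * r₂ * r₃

theorem HasRoots.isElliptic {F : Type*} [Field F] [NeZero (2 : F)] {W : WeierstrassCurve F}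
    {r₁ r₂ r₃ : F} (h : HasRoots W r₁ r₂ r₃) (h₁₂ : r₁ ≠ r₂) (h₁₃ : r₁ ≠ r₃) (h₂₃ : r₂ ≠ r₃) :
    W.IsElliptic := by
  have hΔ : W.Δ = 2 ^ 4 * ((r₁ - r₂) * (r₁ - r₃) * (r₂ - r₃)) ^ 2 := by
    simp only [WeierstrassCurve.Δ, WeierstrassCurve.b₂, WeierstrassCurve.b₄, WeierstrassCurve.b₆,
      WeierstrassCurve.b₈, h.a₁, h.a₂, h.a₃, h.a₄, h.a₆]
    ring
  refine ⟨?_⟩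
  rw [hΔ, isUnit_iff_ne_zero]
  exact mul_ne_zero (pow_ne_zero _ two_ne_zero) (pow_ne_zero _ (mul_ne_zero (mul_ne_zero
    (sub_ne_zero.2 h₁₂) (sub_ne_zero.2 h₁₃)) (sub_ne_zero.2 h₂₃)))

open WeierstrassCurve.Affine in
theorem HasRoots.hasFullRationalTwoTorsion {W : WeierstrassCurve.Affine ℚ} [W.IsElliptic]
    {r₁ r₂ r₃ : ℚ} (h : HasRoots W r₁ r₂ r₃) : HasFullRationalTwoTorsion W := by
  classical
  unfold HasFullRationalTwoTorsion
  intro Q hQ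
  rcases Q with _ | ⟨X, Y, hXY⟩
  · exact ⟨0, map_zero _⟩
  have hQ' : Point.some X Y hXY = -Point.some X Y hXY := by
    rw [eq_neg_iff_add_eq_zero, ← two_nsmul]
    convert hQ
  rw [Point.neg_some, Point.some.injEq] at hQ'
  have e := (equation_iff ..).1 hXY.1
  have hY := hQ'.2
  simp only [negY, WeierstrassCurve.baseChange, WeierstrassCurve.map_a₁, WeierstrassCurve.map_a₂,
    WeierstrassCurve.map_a₃, WeierstrassCurve.map_a₄, WeierstrassCurve.map_a₆, h.a₁, h.a₂, h.a₃,
    h.a₄, h.a₆, map_zero, map_add, map_mul] at e hY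
  have hY0 : Y = 0 := by
    have : 2 * Y = 0 := by linear_combination hY
    simpa using this
  subst hY0
  set i := algebraMap ℚ (AlgebraicClosure ℚ)
  have hprod : (X - i (-r₁)) * ((X - i (-r₂)) * (X - i (-r₃))) = 0 := by
    simp only [map_neg]
    linear_combination -e
  have key : ∀ r : ℚ, (r + r₁) * ((r + r₂) * (r + r₃)) = 0 → X = i r →
      ∃ P : (W⁄ℚ).Point, Point.baseChange (W' := W) ℚ (AlgebraicClosure ℚ) P =
        Point.some X 0 hXY := by
    rintro r hr rfl
    have heq : W.Equation r 0 := by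
      rw [equation_iff, h.a₁, h.a₂, h.a₃, h.a₄, h.a₆]
      linear_combination -hr
    have hns : (W⁄ℚ).Nonsingular r 0 := by
      have := (equation_iff_nonsingular).1 heq
      convert this
      exact W.map_id
    refine ⟨Point.some r 0 hns, ?_⟩
    rw [Point.baseChange, Point.map_some, Point.some.injEq]
    exact ⟨rfl, map_zero _⟩
  rcases mul_eq_zero.1 hprod with h1 | h1
  · exact key _ (by ring) (sub_eq_zero.1 h1)
  rcases mul_eq_zero.1 h1 with h1 | h1
  · exact key _ (by ring) (sub_eq_zero.1 h1)
  · exact key _ (by ring) (sub_eq_zero.1 h1)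

/-- The `qᵢ` are the roots of `q(q - N)² = 4t²x²`; the substitution `X = -t²/q` turns this into the
cubic of `E''`. -/
theorem curveE''_hasRoots {t x q₁ q₂ q₃ : ℚ} (ht : t ≠ 0) (hx : x ≠ 0)
    (h₁ : q₁ + q₂ + q₃ = 2 * (x + (t ^ 2 + 1) ^ 2))
    (h₂ : q₁ * q₂ + q₁ * q₃ + q₂ * q₃ = (x + (t ^ 2 + 1) ^ 2) ^ 2)
    (h₃ : q₁ * q₂ * q₃ = 4 * t ^ 2 * x ^ 2) :
    HasRoots (curveE'' t x) (t ^ 2 / q₁) (t ^ 2 / q₂) (t ^ 2 / q₃) := by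
  have h0 : q₁ * q₂ * q₃ ≠ 0 := by rw [h₃]; positivity
  have hq₁ : q₁ ≠ 0 := by rintro rfl; simp at h0
  have hq₂ : q₂ ≠ 0 := by rintro rfl; simp at h0
  have hq₃ : q₃ ≠ 0 := by rintro rfl; simp at h0
  refine ⟨rfl, ?_, rfl, ?_, ?_⟩ <;> simp only [curveE'']
  · have : t ^ 2 / q₁ + t ^ 2 / q₂ + t ^ 2 / q₃ =
        t ^ 2 * (q₁ * q₂ + q₁ * q₃ + q₂ * q₃) / (q₁ * q₂ * q₃) := by field_simp; ring
    rw [this, h₂, h₃]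
    field_simp
    ring
  · have : t ^ 2 / q₁ * (t ^ 2 / q₂) + t ^ 2 / q₁ * (t ^ 2 / q₃) + t ^ 2 / q₂ * (t ^ 2 / q₃) =
        t ^ 4 * (q₁ + q₂ + q₃) / (q₁ * q₂ * q₃) := by field_simp; ring
    rw [this, h₁, h₃]
    field_simp
    ring
  · have : t ^ 2 / q₁ * (t ^ 2 / q₂) * (t ^ 2 / q₃) = t ^ 6 / (q₁ * q₂ * q₃) := by
      field_simp
    rw [this, h₃]
    field_simp

/-- The triple is the image of the `qᵢ` under `q ↦ σ₃q / (S - q)`. The denominators are nonzero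
since their product is `x²(t² - 1)²`. -/
theorem exists_rational_triple {t x q₁ q₂ q₃ : ℚ} (ht : 1 < t) (hx : x ≠ 0)
    (h₁ : q₁ + q₂ + q₃ = 2 * (x + (t ^ 2 + 1) ^ 2))
    (h₂ : q₁ * q₂ + q₁ * q₃ + q₂ * q₃ = (x + (t ^ 2 + 1) ^ 2) ^ 2)
    (h₃ : q₁ * q₂ * q₃ = 4 * t ^ 2 * x ^ 2) :
    ∃ a b c : ℚ, a + b + c = sigma₁ t x ∧ a * b + a * c + b * c = sigma₂ t x ∧
      a * b * c = sigma₃ t := by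
  have ht0 : t ≠ 0 := by positivity
  have ht1 : t ^ 2 - 1 ≠ 0 := by nlinarith
  obtain ⟨S, hS⟩ : ∃ S, S = (t ^ 2 + 1) ^ 2 := ⟨_, rfl⟩
  rw [← hS] at h₁ h₂
  have hprod : (S - q₁) * (S - q₂) * (S - q₃) = x ^ 2 * (t ^ 2 - 1) ^ 2 := by
    linear_combination -S ^ 2 * h₁ + S * h₂ - h₃ + x ^ 2 * hS
  have h0 : (S - q₁) * (S - q₂) * (S - q₃) ≠ 0 := by rw [hprod]; positivity
  have hq₁ : S - q₁ ≠ 0 := by rintro h; simp [h] at h0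
  have hq₂ : S - q₂ ≠ 0 := by rintro h; simp [h] at h0
  have hq₃ : S - q₃ ≠ 0 := by rintro h; simp [h] at h0
  obtain ⟨s, hs⟩ : ∃ s, s = sigma₃ t := ⟨_, rfl⟩
  have e₁ : s * q₁ / (S - q₁) + s * q₂ / (S - q₂) + s * q₃ / (S - q₃) = sigma₁ t x := by
    have : s * q₁ / (S - q₁) + s * q₂ / (S - q₂) + s * q₃ / (S - q₃) =
        s * (S ^ 2 * (q₁ + q₂ + q₃) - 2 * S * (q₁ * q₂ + q₁ * q₃ + q₂ * q₃) + 3 * (q₁ * q₂ * q₃))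
          / ((S - q₁) * (S - q₂) * (S - q₃)) := by field_simp; ring
    rw [this, hprod, h₁, h₂, h₃, hs, hS, sigma₁, sigma₃]
    field_simp
    ring
  have e₂ : s * q₁ / (S - q₁) * (s * q₂ / (S - q₂)) + s * q₁ / (S - q₁) * (s * q₃ / (S - q₃)) +
      s * q₂ / (S - q₂) * (s * q₃ / (S - q₃)) = sigma₂ t x := by
    have : s * q₁ / (S - q₁) * (s * q₂ / (S - q₂)) + s * q₁ / (S - q₁) * (s * q₃ / (S - q₃)) +
        s * q₂ / (S - q₂) * (s * q₃ / (S - q₃)) =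
        s ^ 2 * (S * (q₁ * q₂ + q₁ * q₃ + q₂ * q₃) - 3 * (q₁ * q₂ * q₃))
          / ((S - q₁) * (S - q₂) * (S - q₃)) := by field_simp; ring
    have hd : 4 + 4 * sigma₃ t ^ 2 = ((t ^ 2 + 1) / t) ^ 2 := by
      rw [sigma₃]; field_simp; ring
    have hp : t ^ 2 + 1 ≠ 0 := by positivity
    rw [this, hprod, h₂, h₃, hs, hS, sigma₂, hd, sigma₁, sigma₃]
    field_simp
    ring
  refine ⟨_, _, _, e₁, e₂, ?_⟩
  have : s * q₁ / (S - q₁) * (s * q₂ / (S - q₂)) * (s * q₃ / (S - q₃)) =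
      s ^ 3 * (q₁ * q₂ * q₃) / ((S - q₁) * (S - q₂) * (S - q₃)) := by field_simp
  rw [this, hprod, h₃, hs, sigma₃]
  field_simp
  ring

/-! ### Nondegeneracy and conclusion -/

theorem mainTheorem5 (t : ℕ) (ht0 : 0 < t) (ht1 : t ≠ 1) (hsq : Squarefree (t ^ 2 + 1))
    (m : ℕ) (hm : 1 < m) :
    ∃ (x y : ℚ) (h : (curveE (t : ℚ)).Nonsingular x y),
      m • pointR (t : ℚ) = WeierstrassCurve.Affine.Point.some x y h ∧ x ≠ 0 ∧
      (curveE'' (t : ℚ) x).IsElliptic ∧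
      HasFullRationalTwoTorsion (curveE'' (t : ℚ) x) ∧
      ∃ a b c : ℚ,
        a + b + c = sigma₁ (t : ℚ) x ∧
        a * b + a * c + b * c = sigma₂ (t : ℚ) x ∧
        a * b * c = sigma₃ (t : ℚ) := by
  have ht : 1 < t := by omega
  have htQ : (1 : ℚ) < t := by exact_mod_cast ht
  have ht0' : (t : ℚ) ≠ 0 := by positivity
  have hR := addOrderOf_pointR ht
  have hinf : ∀ k : ℕ, k ≠ 0 → k • pointR (t : ℚ) ≠ 0 := fun k hk h ↦ hk <| by
    simpa [hR] using addOrderOf_dvd_of_nsmul_eq_zero h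
  have hcube := isCubePoint_nsmul_pointR ht0' m
  rcases hP : m • pointR (t : ℚ) with _ | ⟨x, y, h⟩
  · exact absurd hP (hinf m (by omega))
  rw [hP] at hcube
  obtain ⟨g, k, hy, hx⟩ := hcube
  have hnorm := add_eq_norm_of_isCubePoint h hy hx
  have hy0 : y ≠ 0 := by
    rintro rfl
    apply hinf (m + m) (by omega)
    rw [add_nsmul, hP]
    exact WeierstrassCurve.Affine.Point.add_self_of_Y_eq
      (by simp [WeierstrassCurve.Affine.negY, curveE])
  have hx0 : x ≠ 0 := by
    rintro rfl
    have e := curveE_equation h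
    have e' : (y - (t ^ 2 + 1) ^ 3) * (y + (t ^ 2 + 1) ^ 3) = 0 := by linear_combination e
    rcases mul_eq_zero.1 e' with hy' | hy'
    · obtain rfl : y = (t ^ 2 + 1) ^ 3 := by linear_combination hy'
      apply hinf (m - 1) (by omega)
      have h1 : (m - 1) • pointR (t : ℚ) + pointR t = pointR t := by
        rw [← succ_nsmul, Nat.sub_add_cancel hm.le, hP]
        rfl
      exact add_eq_right.1 h1
    · obtain rfl : y = -(t ^ 2 + 1) ^ 3 := by linear_combination hy'
      apply hinf (m + 1) (by omega)
      rw [succ_nsmul, hP]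
      exact WeierstrassCurve.Affine.Point.add_of_Y_eq rfl
        (by simp [WeierstrassCurve.Affine.negY, curveE])
  have hk0 : k ≠ 0 := by
    rintro rfl
    simp [ht0', hx0] at hx
  have hgk : (g - k) * (g + k) ≠ 0 := by
    intro h0
    have : (t : ℚ) * x = 0 := by rw [hx]; linear_combination k * h0
    simp [ht0', hx0] at this
  have hg : g * (g - 3 * k) * (g + 3 * k) ≠ 0 := by
    convert hy0 using 1
    rw [hy]; ring
  have h₁ : (2 * k) ^ 2 + (k + g) ^ 2 + (k - g) ^ 2 = 2 * (x + ((t : ℚ) ^ 2 + 1) ^ 2) := by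
    rw [hnorm]; ring
  have h₂ : (2 * k) ^ 2 * (k + g) ^ 2 + (2 * k) ^ 2 * (k - g) ^ 2 + (k + g) ^ 2 * (k - g) ^ 2 =
      (x + ((t : ℚ) ^ 2 + 1) ^ 2) ^ 2 := by
    rw [hnorm]; ring
  have h₃ : (2 * k) ^ 2 * (k + g) ^ 2 * (k - g) ^ 2 = 4 * (t : ℚ) ^ 2 * x ^ 2 := by
    linear_combination -4 * (t * x + k * (g ^ 2 - k ^ 2)) * hx
  have hroots := curveE''_hasRoots ht0' hx0 h₁ h₂ h₃
  simp only [mul_ne_zero_iff] at hg hgk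
  have hne : ∀ {a b : ℚ}, (a - b) * (a + b) ≠ 0 → (t : ℚ) ^ 2 / a ^ 2 ≠ (t : ℚ) ^ 2 / b ^ 2 := by
    intro a b hab he
    apply hab
    rw [div_eq_mul_inv, div_eq_mul_inv] at he
    have : a ^ 2 = b ^ 2 := inv_injective (mul_left_cancel₀ (pow_ne_zero 2 ht0') he)
    linear_combination this
  have hell : (curveE'' (t : ℚ) x).IsElliptic := by
    -- The differences of the `qᵢ` factor into `k`, `g`, `g ± k`, `g ± 3k` and constants, all
    -- nonzero because `x` and `y` are.
    refine hroots.isElliptic (hne ?_) (hne ?_) (hne ?_)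
    · convert neg_ne_zero.2 (mul_ne_zero hgk.1 hg.2) using 1; ring
    · convert mul_ne_zero hgk.2 (mul_ne_zero (neg_ne_zero.2 one_ne_zero) hg.1.2) using 1; ring
    · convert mul_ne_zero (mul_ne_zero four_ne_zero hk0) hg.1.1 using 1; ring
  exact ⟨x, y, h, rfl, hx0, hell, hroots.hasFullRationalTwoTorsion,
    exists_rational_triple htQ hx0 h₁ h₂ h₃⟩
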